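/- Let $m\ge 1$ and $d\ge 0$ be integers, and let $M$ be an $m\times d$ integer matrix all of whose row sums are equal. Suppose that $$P=\{x\in\mathbb{R}^d : x\ge 0,\ Mx\le (1,\dots,1)^t\}$$ is a $d$-dimensional integral polytope, that is, the convex hull of finitely many points of $\mathbb{Z}^d$ (such a $P$ is called a $d$-dimensional regular positive reflexive polytope with representing matrix $M$). Let $k$ be the common row sum of $M$ plus $1$. For $t\ge 1$ put $L_P(t)=|tP\cap\mathbb{Z}^d|$. Then there is a (unique) polynomial $h^*(z)$ with integer coefficients, the $h^*$-polynomial of $P$, such that $$1+\sum_{t\ge 1}L_P(t)z^t=\frac{h^*(z)}{(1-z)^{d+1}}$$ as formal power series; it has degree exactly $d-k+1$ and is palindromic, that is, $z^{d-k+1}h^*(1/z)=h^*(z)$. -/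

import Mathlib

open scoped Pointwise

/-- The set `{x ∈ ℝᵈ : x ≥ 0, M x ≤ (1, …, 1)}` attached to an integer matrix `M`. -/
def positivePolyhedron {m d : ℕ} (M : Matrix (Fin m) (Fin d) ℤ) : Set (Fin d → ℝ) :=
  {x | (∀ j, 0 ≤ x j) ∧ ∀ i, ∑ j, (M i j : ℝ) * x j ≤ 1}

/-- An integral (convex) polytope in `ℝᵈ`: the convex hull of finitely many points of `ℤᵈ`. -/
def IsIntegralPolytope {d : ℕ} (P : Set (Fin d → ℝ)) : Prop :=
  ∃ V : Finset (Fin d → ℤ), P = convexHull ℝ ((fun v j => (v j : ℝ)) '' (V : Set (Fin d → ℤ)))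

/-- `P` is a `d`-dimensional positive reflexive polytope in `ℝᵈ` with representing matrix `M`. -/
structure IsPositiveReflexive {m d : ℕ} (P : Set (Fin d → ℝ))
    (M : Matrix (Fin m) (Fin d) ℤ) : Prop where
  integral : IsIntegralPolytope P
  full_dim : affineSpan ℝ P = ⊤
  eq_polyhedron : P = positivePolyhedron M

/-- `P` is a `d`-dimensional regular positive reflexive polytope with representing matrix `M`:
all row sums of `M` are equal. -/
structure IsRegularPositiveReflexive {m d : ℕ} (P : Set (Fin d → ℝ))
    (M : Matrix (Fin m) (Fin d) ℤ) : Prop extends IsPositiveReflexive P M where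
  row_sum_eq : ∀ i i' : Fin m, ∑ j, M i j = ∑ j, M i' j

/-- The number `L_S(t) = |tS ∩ ℤᵈ|` of lattice points in the dilate `tS` (`S` bounded). -/
noncomputable def latticeCount {d : ℕ} (S : Set (Fin d → ℝ)) (t : ℕ) : ℕ :=
  Set.ncard {z : Fin d → ℤ | (fun j => (z j : ℝ)) ∈ (t : ℝ) • S}

/-- The Ehrhart series `1 + ∑_{t ≥ 1} L_S(t) zᵗ`. -/
noncomputable def ehrhartSeries {d : ℕ} (S : Set (Fin d → ℝ)) : PowerSeries ℤ :=
  PowerSeries.mk fun t => if t = 0 then 1 else (latticeCount S t : ℤ)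

/-- `h` is the `h*`-polynomial of the `d`-dimensional polytope `S` in `ℝᵈ`, i.e. the numerator in
`Ehr_S(z) = h(z) / (1 - z)^(d+1)`. There is at most one such `h`. -/
def IsHStarPolynomial {d : ℕ} (S : Set (Fin d → ℝ)) (h : Polynomial ℤ) : Prop :=
  (h : PowerSeries ℤ) = (1 - PowerSeries.X) ^ (d + 1) * ehrhartSeries S

/-- `p` of degree `n` is palindromic: `zⁿ p(1/z) = p(z)`. -/
def IsPalindromic (p : Polynomial ℤ) : Prop :=
  p.reverse = p

open Topology Filter

/-! Put the polytope at height one and count lattice points of the cone over it by height; this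
gives the Ehrhart series. For integer points, `x > 0` means `x ≥ 1` and `Mx < t` means `Mx + 1 ≤ t`.
Since all row sums are `k - 1`, the interior lattice points are exactly the translates by `(1, …, 1,
k)` of the lattice points of the closed cone (`heightSeries_strictCone`), so the interior series is
`z ^ k` times the closed one. Reciprocity (`exists_numerator_reciprocity`) says that the two
numerators over `(1 - z) ^ (d + 1)` are reversals of each other in degree `d + 1`. Together these
facts give the degree and the symmetry (`exists_palindromic_polynomial`). For reciprocity, a generic
weight triangulates the cone (`exists_triangulation`). Moving every point infinitesimally along a
generic interior direction `q` makes the closed cone a disjoint union of half-open simplicial cones;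
moving along `-q` does the same for the interior. Each numerator then counts lattice points in
half-open boxes, and a point reflection of each box exchanges `q` and `-q`. -/

/-- A proper subspace is closed with empty interior, so Baire's theorem applies to the complements.
It supplies both the generic weight and the generic direction. -/
theorem exists_mem_forall_notMem_submodule {V κ : Type*} [NormedAddCommGroup V] [NormedSpace ℝ V]
    [FiniteDimensional ℝ V] [Finite κ] (W : κ → Submodule ℝ V) (hW : ∀ k, W k ≠ ⊤)
    {U : Set V} (hU : IsOpen U) (hne : U.Nonempty) : ∃ x ∈ U, ∀ k, x ∉ W k := by
  have : CompleteSpace V := FiniteDimensional.complete ℝ V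
  have hd : Dense (⋂ k, ((W k : Set V))ᶜ) := by
    refine dense_iInter_of_isOpen (fun k => ?_) fun k => ?_
    · exact (W k).closed_of_finiteDimensional.isOpen_compl
    · rw [← interior_eq_empty_iff_dense_compl]
      by_contra h
      exact hW k ((W k).eq_top_of_nonempty_interior' (Set.nonempty_iff_ne_empty.2 h))
  obtain ⟨x, hx, hxU⟩ := hd.inter_open_nonempty U hU hne
  exact ⟨x, hx, by simpa using hxU⟩

/-! ### Regular triangulations by linear programming duality -/

section Triangulation

variable {V ι : Type*} [AddCommGroup V] [Module ℝ V] [Fintype ι]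

/-- The convex cone generated by a finite family of vectors. -/
def coneHull (v : ι → V) : Set V := {p | ∃ c : ι → ℝ, (∀ i, 0 ≤ c i) ∧ ∑ i, c i • v i = p}

/-- A point is generic if it lies in no proper subspace spanned by members of the family. -/
def AvoidsSpans (v : ι → V) (p : V) : Prop :=
  ∀ S : Set ι, Submodule.span ℝ (v '' S) ≠ ⊤ → p ∉ Submodule.span ℝ (v '' S)

theorem sum_smul_eq_sum_coe {v : ι → V} {c : ι → ℝ} {S : Set ι} [Fintype S]
    (hc : ∀ i, c i ≠ 0 → i ∈ S) : ∑ i, c i • v i = ∑ i : S, c i • v i := by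
  classical
  rw [← Finset.sum_subtype (Finset.univ.filter (· ∈ S)) (by simp) (fun i => c i • v i)]
  refine (Finset.sum_filter_of_ne fun i _ hi => hc i fun h => hi ?_).symm
  rw [h, zero_smul]

/-- On a dependent set of vectors, the weights induced by linear functionals form a proper subspace,
and `w` avoids all of these. Hence the cells cut out by `w` are simplicial. -/
theorem exists_generic_weight (v : ι → V) :
    ∃ w : ι → ℝ, ∀ y : V →ₗ[ℝ] ℝ, LinearIndepOn ℝ v {i | y (v i) = w i} := by
  let W : {S : Set ι // ¬ LinearIndepOn ℝ v S} → Submodule ℝ (ι → ℝ) := fun S =>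
    { carrier := {w | ∃ y : V →ₗ[ℝ] ℝ, ∀ i ∈ S.1, y (v i) = w i}
      zero_mem' := ⟨0, by simp⟩
      add_mem' := by
        rintro a b ⟨y, hy⟩ ⟨z, hz⟩
        exact ⟨y + z, fun i hi => by simp [hy i hi, hz i hi]⟩
      smul_mem' := by
        rintro r a ⟨y, hy⟩
        exact ⟨r • y, fun i hi => by simp [hy i hi]⟩ }
  have hW : ∀ S, W S ≠ ⊤ := by
    classical
    rintro ⟨S, hS⟩ htop
    apply hS
    rw [linearIndepOn_iff']
    intro t g hts hg i hi
    -- If every weight were realizable on `S`, a functional equal to the indicator of `i` would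
    -- isolate the coefficient `g i` in any relation.
    have hmem : (Pi.single i 1 : ι → ℝ) ∈ W ⟨S, hS⟩ := htop ▸ Submodule.mem_top
    obtain ⟨y, hy⟩ := hmem
    have := congrArg y hg
    simp only [map_sum, map_smul, map_zero, smul_eq_mul] at this
    rw [Finset.sum_congr rfl fun j hj => by rw [hy j (hts hj)],
      Finset.sum_eq_single i (fun j _ hj => by simp [hj]) (fun h => absurd hi h)] at this
    simpa using this
  obtain ⟨w, -, hw⟩ := exists_mem_forall_notMem_submodule W hW isOpen_univ Set.univ_nonempty
  refine ⟨w, fun y => ?_⟩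
  by_contra h
  exact hw ⟨_, h⟩ ⟨y, fun i hi => hi⟩

theorem span_support_eq_top {v : ι → V} {p : V} (hp : AvoidsSpans v p) {c : ι → ℝ}
    (hc : ∑ i, c i • v i = p) : Submodule.span ℝ (v '' {i | c i ≠ 0}) = ⊤ := by
  by_contra h
  refine hp _ h (hc ▸ Submodule.sum_mem _ fun i _ => ?_)
  by_cases hi : c i = 0
  · simp [hi]
  · exact Submodule.smul_mem _ _ (Submodule.subset_span ⟨i, hi, rfl⟩)

/-- The feasible set is compact: as all generators have height one, each coefficient is at most `ht
p`. -/
theorem exists_minimal_combination {v : ι → V} {ht : V →ₗ[ℝ] ℝ} (hv : ∀ i, ht (v i) = 1)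
    (w : ι → ℝ) {p : V} (hp : p ∈ coneHull v) :
    ∃ c : ι → ℝ, (∀ i, 0 ≤ c i) ∧ ∑ i, c i • v i = p ∧
      ∀ c' : ι → ℝ, (∀ i, 0 ≤ c' i) → ∑ i, c' i • v i = p → ∑ i, c i * w i ≤ ∑ i, c' i * w i := by
  let f : (ι → ℝ) →ₗ[ℝ] V := Fintype.linearCombination ℝ v
  have hf : ∀ c, f c = ∑ i, c i • v i := fun c => Fintype.linearCombination_apply ..
  obtain ⟨c₀, h₀, h₀'⟩ := hp
  let K : Set (ι → ℝ) := {c | (∀ i, 0 ≤ c i) ∧ f c = p}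
  have hclosed : IsClosed K := by
    have h1 : IsClosed {c : ι → ℝ | ∀ i, 0 ≤ c i} := by
      simp only [Set.ofPred_forall]
      exact isClosed_iInter fun i => isClosed_le continuous_const (continuous_apply i)
    have h2 : IsClosed {c : ι → ℝ | f c = p} := by
      have : {c : ι → ℝ | f c = p} = (fun c => c - c₀) ⁻¹' (LinearMap.ker f : Set (ι → ℝ)) := by
        ext c
        simp [sub_eq_zero, hf c₀, h₀']
      rw [this]
      exact (LinearMap.ker f).closed_of_finiteDimensional.preimage (by fun_prop)
    exact h1.inter h2
  have hcomp : IsCompact K := by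
    refine (isCompact_Icc (a := (0 : ι → ℝ)) (b := fun _ => ht p)).of_isClosed_subset hclosed ?_
    rintro c ⟨hc, hc'⟩
    refine ⟨hc, fun i => ?_⟩
    rw [← hc', hf, map_sum]
    simp only [map_smul, hv, smul_eq_mul, mul_one]
    exact Finset.single_le_sum (fun j _ => hc j) (Finset.mem_univ i)
  obtain ⟨c, hc, hmin⟩ := hcomp.exists_isMinOn ⟨c₀, h₀, by rw [hf, h₀']⟩
    (f := fun c => ∑ i, c i * w i) (by fun_prop)
  exact ⟨c, hc.1, by rw [← hf, hc.2], fun c' h1 h2 => hmin ⟨h1, by rw [hf, h2]⟩⟩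

/-- This is strong duality with complementary slackness. The support of an optimal `c` spans because
`p` is generic, so prices on the support extend to a functional on all of `V`. -/
theorem exists_dual_functional {v : ι → V} {ht : V →ₗ[ℝ] ℝ} (hv : ∀ i, ht (v i) = 1)
    (w : ι → ℝ) {p : V} (hp : p ∈ coneHull v) (hgen : AvoidsSpans v p) :
    ∃ (y : V →ₗ[ℝ] ℝ) (c : ι → ℝ), (∀ i, y (v i) ≤ w i) ∧ (∀ i, 0 ≤ c i) ∧
      (∀ i, c i ≠ 0 → y (v i) = w i) ∧ ∑ i, c i • v i = p := by
  classical
  obtain ⟨c, hc, hcp, hmin⟩ := exists_minimal_combination hv w hp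
  -- Scaling by `c i` confines perturbations to the support of `c`, where small ones of either sign
  -- preserve nonnegativity.
  let f : (ι → ℝ) →ₗ[ℝ] V := Fintype.linearCombination ℝ fun i => c i • v i
  have hf : ∀ u, f u = ∑ i, (c i * u i) • v i := fun u => by
    simp [f, Fintype.linearCombination_apply, smul_smul, mul_comm]
  have hsurj : LinearMap.range f = ⊤ := by
    rw [eq_top_iff, ← span_support_eq_top hgen hcp, Submodule.span_le]
    rintro _ ⟨i, hi, rfl⟩
    refine ⟨Pi.single i (c i)⁻¹, ?_⟩
    rw [hf, Finset.sum_eq_single i (fun j _ hj => by simp [hj]) (by simp)]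
    simp [mul_inv_cancel₀ hi]
  obtain ⟨g, hg⟩ := f.exists_rightInverse_of_surjective hsurj
  have hfg : ∀ x, f (g x) = x := fun x => by
    simpa using congrArg (fun l => l x) hg
  let y : V →ₗ[ℝ] ℝ := (Fintype.linearCombination ℝ fun i => c i * w i) ∘ₗ g
  have hy : ∀ x, y x = ∑ i, c i * g x i * w i := fun x => by
    simp only [y, LinearMap.comp_apply, Fintype.linearCombination_apply, smul_eq_mul]
    exact Finset.sum_congr rfl fun i _ => by ring
  have small : ∀ u : ι → ℝ, ∃ t : ℝ, 0 < t ∧ ∀ i, 0 ≤ 1 + t * u i := by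
    intro u
    have : ∀ᶠ t in 𝓝[>] (0 : ℝ), ∀ i, 0 ≤ 1 + t * u i := by
      rw [eventually_all]
      intro i
      have h : Tendsto (fun t : ℝ => 1 + t * u i) (𝓝[>] 0) (𝓝 (1 + 0 * u i)) :=
        (Continuous.tendsto (by fun_prop) 0).mono_left nhdsWithin_le_nhds
      rw [zero_mul, add_zero] at h
      exact (h.eventually (lt_mem_nhds zero_lt_one)).mono fun _ => le_of_lt
    obtain ⟨t, h1, h2⟩ := (this.and self_mem_nhdsWithin).exists
    exact ⟨t, h2, h1⟩
  -- First-order optimality of `c` along feasible directions.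
  have key : ∀ (u e : ι → ℝ), (∀ i, 0 ≤ e i) → ∑ i, (c i * u i + e i) • v i = 0 →
      0 ≤ ∑ i, (c i * u i + e i) * w i := by
    intro u e he hue
    obtain ⟨t, ht0, htu⟩ := small u
    have h := hmin (fun i => c i + t * (c i * u i + e i)) (fun i => by
      have h1 := mul_nonneg (hc i) (htu i)
      have h2 := mul_nonneg ht0.le (he i)
      linarith) (by
      simp only [add_smul _ (t * _), mul_smul t, Finset.sum_add_distrib, ← Finset.smul_sum, hue,
        hcp, smul_zero, add_zero])
    simp only [add_mul _ (t * _), mul_assoc t, Finset.sum_add_distrib (f := fun i => c i * w i),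
      ← Finset.mul_sum] at h
    have : 0 ≤ t * ∑ i, (c i * u i + e i) * w i := by linarith
    exact nonneg_of_mul_nonneg_right this ht0
  have hle : ∀ j, y (v j) ≤ w j := by
    intro j
    -- Bring in `v j` and remove its expression in the support vectors.
    have h := key (fun i => -g (v j) i) (Pi.single j 1)
      (fun i => by by_cases h : i = j <;> simp [h]) (by
        simp only [add_smul, mul_neg, neg_smul, Finset.sum_add_distrib, Finset.sum_neg_distrib]
        rw [← hf, hfg]
        simp [Pi.single_apply, ite_smul])
    simp only [add_mul, mul_neg, neg_mul, Finset.sum_add_distrib, Finset.sum_neg_distrib] at h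
    rw [← hy] at h
    simp [Pi.single_apply] at h
    linarith
  refine ⟨y, c, hle, hc, ?_, hcp⟩
  -- Comparing `c` with the expression of `p` chosen by `g` bounds the optimal cost by `y p`, which
  -- forces zero slack on the support.
  have h := key (fun i => g p i - 1) 0 (by simp) (by
    simp only [Pi.zero_apply, add_zero, mul_sub, mul_one, sub_smul, Finset.sum_sub_distrib, hcp]
    rw [← hf, hfg, sub_self])
  simp only [Pi.zero_apply, add_zero, mul_sub, mul_one, sub_mul, Finset.sum_sub_distrib] at h
  rw [← hy] at h
  have hyp : y p = ∑ i, c i * y (v i) := by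
    conv_lhs => rw [← hcp]
    simp
  have hz : ∑ i, c i * (w i - y (v i)) = 0 := by
    refine le_antisymm ?_ (Finset.sum_nonneg fun i _ => mul_nonneg (hc i) (sub_nonneg.2 (hle i)))
    simp only [mul_sub, Finset.sum_sub_distrib]
    linarith
  intro i hi
  have := (Finset.sum_eq_zero_iff_of_nonneg fun i _ =>
    mul_nonneg (hc i) (sub_nonneg.2 (hle i))).1 hz i (Finset.mem_univ i)
  rcases mul_eq_zero.1 this with h | h
  · exact absurd h hi
  · linarith

/-- A finitely generated cone whose generators lie at height one has a triangulation into
simplicial cones, such that each generic point of the cone lies in exactly one of them. -/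
theorem exists_triangulation [FiniteDimensional ℝ V] (v : ι → V) (ht : V →ₗ[ℝ] ℝ)
    (hv : ∀ i, ht (v i) = 1) :
    ∃ (T : Finset (Set ι))
      (b : T → Module.Basis (Fin (Module.finrank ℝ V)) ℝ V),
      (∀ a i, b a i ∈ Set.range v) ∧
      (∀ p, AvoidsSpans v p → ∀ a i, (b a).repr p i ≠ 0) ∧
      (∀ a p, (∀ i, 0 ≤ (b a).repr p i) → p ∈ coneHull v) ∧
      ∀ p ∈ coneHull v, AvoidsSpans v p → ∃! a, ∀ i, 0 ≤ (b a).repr p i := by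
  classical
  obtain ⟨w, hw⟩ := exists_generic_weight v
  -- The cells are the full-dimensional faces of the lower hull of the lift by `w`: the spanning
  -- tight sets of dual feasible functionals.
  let T : Finset (Set ι) := Finset.univ.filter fun S => ∃ y : V →ₗ[ℝ] ℝ,
    (∀ i, y (v i) ≤ w i) ∧ S = {i | y (v i) = w i} ∧ Submodule.span ℝ (v '' S) = ⊤
  have hT : ∀ S : T, ∃ y : V →ₗ[ℝ] ℝ,
      (∀ i, y (v i) ≤ w i) ∧ S.1 = {i | y (v i) = w i} ∧ Submodule.span ℝ (v '' S.1) = ⊤ :=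
    fun S => (Finset.mem_filter.1 S.2).2
  choose y hy hyS hspan using hT
  have hli : ∀ S : T, LinearIndepOn ℝ v S.1 := fun S => by rw [hyS S]; exact hw _
  let b₀ : ∀ S : T, Module.Basis S.1 ℝ V := fun S => Module.Basis.mk (hli S) (by
    rw [← hspan S, Set.image_eq_range])
  have hb₀ : ∀ (S : T) i, b₀ S i = v i := fun S i => Module.Basis.mk_apply ..
  let e : ∀ S : T, S.1 ≃ Fin (Module.finrank ℝ V) := fun S =>
    Fintype.equivFinOfCardEq (Module.finrank_eq_card_basis (b₀ S)).symm
  have hsum : ∀ (S : T) (p : V),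
      ∑ i, (if h : i ∈ S.1 then (b₀ S).repr p ⟨i, h⟩ else 0) • v i = p := by
    intro S p
    rw [sum_smul_eq_sum_coe (S := S.1) fun i hi => by by_contra h; simp [h] at hi]
    conv_rhs => rw [← (b₀ S).sum_repr p]
    exact Finset.sum_congr rfl fun i _ => by simp [hb₀]
  have hpos : ∀ (S : T) p, (∀ j, 0 ≤ ((b₀ S).reindex (e S)).repr p j) → ∀ i,
      0 ≤ (if h : i ∈ S.1 then (b₀ S).repr p ⟨i, h⟩ else 0) := by
    intro S p hp i
    split_ifs with h
    · simpa using hp (e S ⟨i, h⟩)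
    · rfl
  refine ⟨T, fun S => (b₀ S).reindex (e S), fun a i => ⟨_, (by simp [hb₀]; rfl)⟩, ?_, ?_, ?_⟩
  · intro p hp S j h0
    have hs := span_support_eq_top hp (hsum S p)
    set i := (e S).symm j with hi
    have h0' : (b₀ S).repr p i = 0 := by simpa using h0
    -- A vanishing coordinate would put the support of `p`, which spans, inside a coordinate
    -- hyperplane.
    have : (b₀ S).coord i = 0 := by
      have hle : Submodule.span ℝ (v '' {k | (if h : k ∈ S.1 then (b₀ S).repr p ⟨k, h⟩ else 0) ≠ 0})
          ≤ LinearMap.ker ((b₀ S).coord i) := by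
        rw [Submodule.span_le]
        rintro _ ⟨k, hk, rfl⟩
        by_cases h : k ∈ S.1
        · have hki : (⟨k, h⟩ : S.1) ≠ i := by
            intro hki
            simp [h, hki, h0'] at hk
          have := (b₀ S).repr_self_apply ⟨k, h⟩ i
          rw [hb₀, if_neg hki] at this
          simpa using this
        · simp [h] at hk
      rw [hs, top_le_iff, LinearMap.ker_eq_top] at hle
      exact hle
    have h1 := congrArg (fun l => l (b₀ S i)) this
    simp at h1
  · intro S p hp
    exact ⟨_, hpos S p hp, hsum S p⟩
  · intro p hp hgen
    obtain ⟨z, c, hz, hc, hcz, hcp⟩ := exists_dual_functional hv w hp hgen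
    have hspan' : Submodule.span ℝ (v '' {i | z (v i) = w i}) = ⊤ :=
      top_le_iff.1 ((span_support_eq_top hgen hcp).symm.le.trans
        (Submodule.span_mono (Set.image_mono fun i hi => hcz i hi)))
    let S : T := ⟨{i | z (v i) = w i}, by
      simp only [T, Finset.mem_filter, Finset.mem_univ, true_and]
      exact ⟨z, hz, rfl, hspan'⟩⟩
    -- A cell containing `p` maximizes `y p` over all cells. Two maximizers agree on the spanning
    -- support of `p`, hence are equal; this gives uniqueness.
    have hle : ∀ (A B : T), (∀ j, 0 ≤ ((b₀ A).reindex (e A)).repr p j) → y B p ≤ y A p ∧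
        (y A p ≤ y B p → y A = y B) := by
      intro A B hA
      set c := fun i => (if h : i ∈ A.1 then (b₀ A).repr p ⟨i, h⟩ else 0) with hcdef
      have hc0 : ∀ i, 0 ≤ c i := hpos A p hA
      have hcA : ∀ i, c i ≠ 0 → y A (v i) = w i := fun i hi => by
        by_cases h : i ∈ A.1
        · rw [hyS A] at h
          exact h
        · simp [hcdef, h] at hi
      have hAB : ∀ i, 0 ≤ c i * (y A (v i) - y B (v i)) := fun i => by
        by_cases hi : c i = 0
        · simp [hi]
        · exact mul_nonneg (hc0 i) (by rw [hcA i hi]; linarith [hy B i])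
      have hd : y A p - y B p = ∑ i, c i * (y A (v i) - y B (v i)) := by
        have h : ∀ l : V →ₗ[ℝ] ℝ, l p = ∑ i, c i * l (v i) := fun l => by
          conv_lhs => rw [← hsum A p]
          rw [map_sum]
          exact Finset.sum_congr rfl fun i _ => by rw [map_smul, smul_eq_mul]
        rw [h, h, ← Finset.sum_sub_distrib]
        exact Finset.sum_congr rfl fun i _ => by ring
      refine ⟨by linarith [Finset.sum_nonneg fun i (_ : i ∈ Finset.univ) => hAB i], fun h => ?_⟩
      have hz : ∑ i, c i * (y A (v i) - y B (v i)) = 0 :=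
        le_antisymm (by linarith) (Finset.sum_nonneg fun i _ => hAB i)
      rw [Finset.sum_eq_zero_iff_of_nonneg fun i _ => hAB i] at hz
      refine LinearMap.ext_on (span_support_eq_top hgen (hsum A p)) ?_
      rintro _ ⟨i, hi, rfl⟩
      rcases mul_eq_zero.1 (hz i (Finset.mem_univ i)) with h' | h'
      · exact absurd h' hi
      · linarith
    have hS : ∀ j, 0 ≤ ((b₀ S).reindex (e S)).repr p j := by
      intro j
      have hrepr : (b₀ S).repr p ((e S).symm j) = c ((e S).symm j) := by
        have hp' : p = ∑ i : S.1, c i • b₀ S i := by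
          simp only [hb₀]
          rw [← sum_smul_eq_sum_coe (S := S.1) hcz, hcp]
        conv_lhs => rw [hp']
        rw [Module.Basis.repr_sum_self]
      simpa [hrepr] using hc _
    refine ⟨S, hS, fun A hA => ?_⟩
    have := (hle A S hA).2 (hle S A hS).1
    exact Subtype.ext (by rw [hyS A, hyS S, this])

end Triangulation

/-! ### Half-open simplicial cones and their boxes -/

section HalfOpen

variable {V κ : Type*} [AddCommGroup V] [Module ℝ V]

/-- The series whose `t`-th coefficient counts the points of `S` at height `t`. -/
noncomputable def heightSeries (ht : V →ₗ[ℝ] ℝ) (S : Set V) : PowerSeries ℤ :=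
  PowerSeries.mk fun t => ({x | x ∈ S ∧ ht x = t}.ncard : ℤ)

/-- The simplicial cone of the basis `b` without the facets which `q` lies behind, cut down to a
half-open box in the coordinates belonging to `J`. -/
def halfOpenBox (b : Module.Basis κ ℝ V) (q : V) (J : Set κ) : Set V :=
  {x | (∀ i, 0 ≤ b.repr x i ∧ (b.repr x i = 0 → 0 < b.repr q i)) ∧
    ∀ i ∈ J, b.repr x i ≤ 1 ∧ (b.repr x i = 1 → b.repr q i < 0)}

theorem height_eq_sum [Fintype κ] {b : Module.Basis κ ℝ V} {ht : V →ₗ[ℝ] ℝ}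
    (hb : ∀ i, ht (b i) = 1) (x : V) : ht x = ∑ i, b.repr x i := by
  conv_lhs => rw [← b.sum_repr x, map_sum]
  exact Finset.sum_congr rfl fun i _ => by rw [map_smul, hb, smul_eq_mul, mul_one]

/-- Division with remainder in coordinate `j`. The allowed interval is `[0, 1)` if `q` has positive
coordinate and `(0, 1]` if negative, so its integer translates tile without overlap. -/
theorem mem_halfOpenBox_insert_iff {b : Module.Basis κ ℝ V} {q : V} (hq : ∀ i, b.repr q i ≠ 0)
    {J : Set κ} {j : κ} (hj : j ∉ J) {x : V} :
    x ∈ halfOpenBox b q J ↔ x ∈ halfOpenBox b q (insert j J) ∨ x - b j ∈ halfOpenBox b q J := by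
  classical
  have hr : ∀ i, b.repr (x - b j) i = b.repr x i - if j = i then 1 else 0 := fun i => by
    rw [map_sub, Finsupp.sub_apply, b.repr_self_apply]
  constructor
  · rintro ⟨h1, h2⟩
    by_cases h : b.repr x j ≤ 1 ∧ (b.repr x j = 1 → b.repr q j < 0)
    · refine Or.inl ⟨h1, fun i hi => ?_⟩
      rcases hi with rfl | hi
      · exact h
      · exact h2 i hi
    · refine Or.inr ⟨fun i => ?_, fun i hi => ?_⟩
      · rw [hr]
        by_cases hij : j = i
        · subst hij
          simp only [if_true]
          by_cases h' : b.repr x j ≤ 1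
          · have h3 : b.repr x j = 1 ∧ 0 ≤ b.repr q j := by simpa [h'] using h
            exact ⟨by linarith [h3.1], fun _ => lt_of_le_of_ne h3.2 (hq j).symm⟩
          · exact ⟨by linarith, fun h'' => by linarith⟩
        · simpa [hij] using h1 i
      · rw [hr, if_neg (ne_of_mem_of_not_mem hi hj).symm, sub_zero]
        exact h2 i hi
  · rintro (⟨h1, h2⟩ | ⟨h1, h2⟩)
    · exact ⟨h1, fun i hi => h2 i (Set.mem_insert_of_mem _ hi)⟩
    · refine ⟨fun i => ?_, fun i hi => ?_⟩
      · have h := h1 i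
        rw [hr] at h
        by_cases hij : j = i
        · rw [if_pos hij] at h
          exact ⟨by linarith, fun h' => by linarith⟩
        · simpa [hij] using h
      · have h := h2 i hi
        rwa [hr, if_neg (ne_of_mem_of_not_mem hi hj).symm, sub_zero] at h

theorem disjoint_halfOpenBox_insert {b : Module.Basis κ ℝ V} {q : V} {J : Set κ} {j : κ} {x : V}
    (h : x ∈ halfOpenBox b q (insert j J)) : x - b j ∉ halfOpenBox b q J := by
  rintro ⟨h', -⟩
  have h1 := h.2 j (Set.mem_insert _ _)
  have h2 := h' j
  rw [map_sub, Finsupp.sub_apply, b.repr_self, Finsupp.single_eq_same] at h2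
  have h3 : b.repr x j = 1 := by linarith [h1.1, h2.1]
  linarith [h1.2 h3, h2.2 (by linarith)]

variable [Fintype κ] {b : Module.Basis κ ℝ V} {q : V} {ht : V →ₗ[ℝ] ℝ} {L : AddSubgroup V}

/-- The points not in the smaller box are the translate of the whole set by the lattice vector `b
j`, of height one. -/
theorem one_sub_X_mul_heightSeries (hb : ∀ i, ht (b i) = 1) (hL : ∀ i, b i ∈ L)
    (hq : ∀ i, b.repr q i ≠ 0) {J : Set κ} {j : κ} (hj : j ∉ J)
    (hfin : ∀ t : ℕ, {x | x ∈ (L : Set V) ∩ halfOpenBox b q J ∧ ht x = t}.Finite) :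
    (1 - PowerSeries.X) * heightSeries ht (L ∩ halfOpenBox b q J) =
      heightSeries ht (L ∩ halfOpenBox b q (insert j J)) := by
  have hunion : ∀ t : ℝ, {x | x ∈ (L : Set V) ∩ halfOpenBox b q J ∧ ht x = t} =
      {x | x ∈ (L : Set V) ∩ halfOpenBox b q (insert j J) ∧ ht x = t} ∪
      (fun x => x + b j) '' {x | x ∈ (L : Set V) ∩ halfOpenBox b q J ∧ ht x = t - 1} := by
    intro t
    ext x
    have hmem : x ∈ (fun x => x + b j) '' {x | x ∈ (L : Set V) ∩ halfOpenBox b q J ∧ ht x = t - 1} ↔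
        x ∈ L ∧ x - b j ∈ halfOpenBox b q J ∧ ht x = t := by
      constructor
      · rintro ⟨y, ⟨⟨h1, h2⟩, h3⟩, rfl⟩
        exact ⟨L.add_mem h1 (hL j), by simpa using h2, by simp [h3, hb]⟩
      · rintro ⟨h1, h2, h3⟩
        exact ⟨x - b j, ⟨⟨L.sub_mem h1 (hL j), h2⟩, by simp [h3, hb]⟩, by simp⟩
    rw [Set.mem_union, hmem]
    simp only [Set.mem_ofPred_eq, Set.mem_inter_iff, SetLike.mem_coe,
      mem_halfOpenBox_insert_iff hq hj (x := x)]
    tauto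
  have hcard : ∀ t : ℕ, {x | x ∈ (L : Set V) ∩ halfOpenBox b q J ∧ ht x = t}.ncard =
      {x | x ∈ (L : Set V) ∩ halfOpenBox b q (insert j J) ∧ ht x = t}.ncard +
      {x | x ∈ (L : Set V) ∩ halfOpenBox b q J ∧ ht x = t - 1}.ncard := by
    intro t
    have hf := hfin t
    rw [hunion] at hf ⊢
    rw [Set.ncard_union_eq _ (hf.subset Set.subset_union_left)
      (hf.subset Set.subset_union_right), Set.ncard_image_of_injective _ (add_left_injective _)]
    rw [Set.disjoint_left]
    rintro x ⟨⟨-, h1⟩, -⟩ ⟨y, ⟨⟨-, h2⟩, -⟩, rfl⟩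
    exact disjoint_halfOpenBox_insert h1 (by simpa using h2)
  ext t
  rw [sub_mul, one_mul, map_sub]
  cases t with
  | zero =>
    have hempty : {x | x ∈ (L : Set V) ∩ halfOpenBox b q J ∧ ht x = ((0 : ℕ) : ℝ) - 1} = ∅ := by
      rw [Set.eq_empty_iff_forall_notMem]
      rintro x ⟨⟨-, h1, -⟩, h2⟩
      rw [height_eq_sum hb] at h2
      have := Finset.sum_nonneg fun i (_ : i ∈ Finset.univ) => (h1 i).1
      norm_num at h2
      linarith
    have h := hcard 0
    rw [hempty, Set.ncard_empty, add_zero] at h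
    rw [PowerSeries.coeff_zero_X_mul, sub_zero, heightSeries, heightSeries, PowerSeries.coeff_mk,
      PowerSeries.coeff_mk, h]
  | succ t =>
    have h := hcard (t + 1)
    rw [PowerSeries.coeff_succ_X_mul]
    simp only [heightSeries, PowerSeries.coeff_mk]
    rw [h]
    push_cast
    simp

theorem one_sub_X_pow_mul_heightSeries (hb : ∀ i, ht (b i) = 1) (hL : ∀ i, b i ∈ L)
    (hq : ∀ i, b.repr q i ≠ 0)
    (hfin : ∀ t : ℕ, {x | x ∈ (L : Set V) ∩ halfOpenBox b q ∅ ∧ ht x = t}.Finite) :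
    (1 - PowerSeries.X) ^ Fintype.card κ * heightSeries ht (L ∩ halfOpenBox b q ∅) =
      heightSeries ht (L ∩ halfOpenBox b q Set.univ) := by
  classical
  have key : ∀ J : Finset κ, (1 - PowerSeries.X) ^ J.card * heightSeries ht (L ∩ halfOpenBox b q ∅) =
      heightSeries ht (L ∩ halfOpenBox b q (J : Set κ)) := by
    intro J
    induction J using Finset.induction_on with
    | empty => simp
    | insert j J hj ih =>
      rw [Finset.card_insert_of_notMem hj, pow_succ', mul_assoc, ih, Finset.coe_insert]
      refine one_sub_X_mul_heightSeries hb hL hq (by simpa using hj) fun t => ?_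
      refine (hfin t).subset ?_
      rintro x ⟨⟨h1, h2⟩, h3⟩
      exact ⟨⟨h1, h2.1, by simp⟩, h3⟩
  simpa using key Finset.univ

theorem coeff_heightSeries_box_of_lt (hb : ∀ i, ht (b i) = 1) {t : ℕ} (h : Fintype.card κ < t) :
    PowerSeries.coeff t (heightSeries ht (L ∩ halfOpenBox b q Set.univ)) = 0 := by
  rw [heightSeries, PowerSeries.coeff_mk, Nat.cast_eq_zero]
  convert Set.ncard_empty V
  rw [Set.eq_empty_iff_forall_notMem]
  rintro x ⟨⟨-, -, h1⟩, h2⟩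
  rw [height_eq_sum hb] at h2
  have h3 := Finset.sum_le_sum fun i (_ : i ∈ Finset.univ) => (h1 i trivial).1
  simp only [Finset.sum_const, Finset.card_univ, nsmul_eq_mul, mul_one] at h3
  rw [h2] at h3
  exact absurd (Nat.cast_le.1 h3) (not_le.2 h)

/-- The reflection `x ↦ ∑ i, b i - x` preserves the lattice and exchanges `[0, 1)` with `(0, 1]` in
each coordinate, which amounts to replacing `q` by `-q`. -/
theorem coeff_heightSeries_box_reflect (hb : ∀ i, ht (b i) = 1) (hL : ∀ i, b i ∈ L)
    {t : ℕ} (h : t ≤ Fintype.card κ) :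
    PowerSeries.coeff (Fintype.card κ - t) (heightSeries ht (L ∩ halfOpenBox b q Set.univ)) =
      PowerSeries.coeff t (heightSeries ht (L ∩ halfOpenBox b (-q) Set.univ)) := by
  simp only [heightSeries, PowerSeries.coeff_mk, Nat.cast_inj]
  have hmap : ∀ (p x : V), x ∈ halfOpenBox b p Set.univ →
      ∑ i, b i - x ∈ halfOpenBox b (-p) Set.univ := by
    intro p x hx
    have hr : ∀ i, b.repr (∑ i, b i - x) i = 1 - b.repr x i := fun i => by
      classical
      simp [Finsupp.single_apply]
    refine ⟨fun i => ?_, fun i _ => ?_⟩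
    · rw [hr, map_neg, Finsupp.neg_apply]
      have := hx.2 i trivial
      exact ⟨by linarith, fun h => by linarith [this.2 (by linarith)]⟩
    · rw [hr, map_neg, Finsupp.neg_apply]
      have := hx.1 i
      exact ⟨by linarith, fun h => by linarith [this.2 (by linarith)]⟩
  have hsum : ht (∑ i, b i) = Fintype.card κ := by simp [hb]
  have hsL : ∑ i, b i ∈ L := L.sum_mem fun i _ => hL i
  have hcast : ((Fintype.card κ - t : ℕ) : ℝ) = Fintype.card κ - t := by push_cast [h]; ring
  refine Set.ncard_congr (fun x _ => ∑ i, b i - x) ?_ ?_ ?_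
  · rintro x ⟨⟨h1, h2⟩, h3⟩
    exact ⟨⟨L.sub_mem hsL h1, hmap _ _ h2⟩, by rw [map_sub, hsum, h3, hcast]; ring⟩
  · intro x y _ _ hxy
    simpa using hxy
  · rintro x ⟨⟨h1, h2⟩, h3⟩
    refine ⟨∑ i, b i - x, ⟨⟨L.sub_mem hsL h1, ?_⟩, by rw [map_sub, hsum, h3, hcast]⟩, by simp⟩
    simpa using hmap _ _ h2

/-- A nonzero coordinate keeps its sign under a small shift; a zero one takes the sign of the
coordinate of `q`. -/
theorem eventually_repr_nonneg_iff (hq : ∀ i, b.repr q i ≠ 0) (x : V) :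
    ∀ᶠ ε in 𝓝[>] (0 : ℝ), (∀ i, 0 ≤ b.repr (x + ε • q) i) ↔ x ∈ halfOpenBox b q ∅ := by
  have key : ∀ i, ∀ᶠ ε in 𝓝[>] (0 : ℝ), 0 ≤ b.repr (x + ε • q) i ↔
      (0 ≤ b.repr x i ∧ (b.repr x i = 0 → 0 < b.repr q i)) := by
    intro i
    have hlim : Tendsto (fun ε : ℝ => b.repr x i + ε * b.repr q i) (𝓝[>] 0)
        (𝓝 (b.repr x i + 0 * b.repr q i)) :=
      (Continuous.tendsto (by fun_prop) 0).mono_left nhdsWithin_le_nhds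
    rw [zero_mul, add_zero] at hlim
    simp only [map_add, map_smul, Finsupp.add_apply, Finsupp.smul_apply, smul_eq_mul]
    rcases lt_trichotomy (b.repr x i) 0 with h | h | h
    · filter_upwards [hlim.eventually (gt_mem_nhds h)] with ε hε
      exact ⟨fun h' => by linarith, fun h' => by linarith [h'.1]⟩
    · filter_upwards [self_mem_nhdsWithin] with ε hε
      rw [h, zero_add, mul_nonneg_iff_of_pos_left hε]
      exact ⟨fun h' => ⟨le_rfl, fun _ => lt_of_le_of_ne h' (hq i).symm⟩, fun h' => (h'.2 rfl).le⟩
    · filter_upwards [hlim.eventually (lt_mem_nhds h)] with ε hε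
      exact ⟨fun _ => ⟨h.le, fun h' => absurd h' h.ne'⟩, fun _ => hε.le⟩
  filter_upwards [eventually_all.2 key] with ε hε
  rw [forall_congr' hε]
  simp [halfOpenBox]

end HalfOpen

/-! ### Ehrhart–Macdonald reciprocity -/

section Reciprocity

variable {V ι : Type*} [AddCommGroup V] [Module ℝ V] [Fintype ι]

/-- A line with direction outside a subspace meets it at most once, and there are finitely many
spans to avoid. -/
theorem AvoidsSpans.eventually_add_smul {v : ι → V} {q : V} (hq : AvoidsSpans v q) (x : V) :
    ∀ᶠ ε in 𝓝[>] (0 : ℝ), AvoidsSpans v (x + ε • q) := by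
  simp only [AvoidsSpans]
  rw [eventually_all]
  intro S
  rw [eventually_imp_distrib_left]
  intro hS
  have hsub : {ε : ℝ | x + ε • q ∈ Submodule.span ℝ (v '' S)}.Subsingleton := by
    intro a ha c hc
    by_contra hac
    have h := Submodule.smul_mem (Submodule.span ℝ (v '' S)) (a - c)⁻¹ (Submodule.sub_mem _ ha hc)
    rw [add_sub_add_left_eq_sub, ← sub_smul, smul_smul, inv_mul_cancel₀ (sub_ne_zero.2 hac),
      one_smul] at h
    exact hq S hS h
  -- The value zero is discarded since `x` itself may lie in the span.
  have h0 := (hsub.finite.subset (Set.sdiff_subset (t := {0}))).isClosed.isOpen_compl.mem_nhds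
    (x := (0 : ℝ)) (by simp)
  filter_upwards [nhdsWithin_le_nhds h0, self_mem_nhdsWithin] with ε h1 h2 h3
  exact h1 ⟨h3, ne_of_gt h2⟩

omit [Fintype ι] in
theorem AvoidsSpans.neg {v : ι → V} {q : V} (hq : AvoidsSpans v q) : AvoidsSpans v (-q) :=
  fun S hS h => hq S hS (by simpa using h)

/-- Decomposition of the lattice points of a cone, with a part of its boundary removed according
to the direction `q`, into half-open simplicial cones. -/
theorem heightSeries_eq_sum {v : ι → V} {ht : V →ₗ[ℝ] ℝ} {L : AddSubgroup V}
    {α κ : Type*} [Fintype α] [Fintype κ] {b : α → Module.Basis κ ℝ V}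
    (hcone : ∀ a p, (∀ i, 0 ≤ (b a).repr p i) → p ∈ coneHull v)
    (huniq : ∀ p ∈ coneHull v, AvoidsSpans v p → ∃! a, ∀ i, 0 ≤ (b a).repr p i)
    {q : V} (hq : AvoidsSpans v q) (hq0 : ∀ a i, (b a).repr q i ≠ 0) {D : Set V}
    (hD : ∀ x, ∀ᶠ ε in 𝓝[>] (0 : ℝ), x + ε • q ∈ coneHull v ↔ x ∈ D)
    (hfin : ∀ t : ℕ, {x | x ∈ (L : Set V) ∩ coneHull v ∧ ht x = t}.Finite) :
    heightSeries ht (L ∩ D) = ∑ a, heightSeries ht (L ∩ halfOpenBox (b a) q ∅) := by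
  have key : ∀ x, (x ∈ D → ∃! a, x ∈ halfOpenBox (b a) q ∅) ∧
      (∀ a, x ∈ halfOpenBox (b a) q ∅ → x ∈ D) := by
    intro x
    -- One small `ε` serves `D`, genericity and all cells at once, so unique containment of `x + ε •
    -- q` passes to the half-open cones.
    obtain ⟨ε, h1, h2, h3⟩ := ((hD x).and ((hq.eventually_add_smul x).and
      (eventually_all.2 fun a => eventually_repr_nonneg_iff (hq0 a) x))).exists
    simp only [← h3, ← h1]
    exact ⟨fun h => huniq _ h h2, fun a => hcone a _⟩
  have hsub : ∀ a, halfOpenBox (b a) q ∅ ⊆ coneHull v := fun a x hx =>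
    hcone a x fun i => (hx.1 i).1
  have hunion : ∀ t : ℕ, {x | x ∈ (L : Set V) ∩ D ∧ ht x = t} =
      ⋃ a, {x | x ∈ (L : Set V) ∩ halfOpenBox (b a) q ∅ ∧ ht x = t} := by
    intro t
    ext x
    simp only [Set.mem_ofPred_eq, Set.mem_inter_iff, Set.mem_iUnion]
    constructor
    · rintro ⟨⟨h1, h2⟩, h3⟩
      obtain ⟨a, ha, -⟩ := (key x).1 h2
      exact ⟨a, ⟨h1, ha⟩, h3⟩
    · rintro ⟨a, ⟨h1, h2⟩, h3⟩
      exact ⟨⟨h1, (key x).2 a h2⟩, h3⟩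
  ext t
  rw [map_sum]
  simp only [heightSeries, PowerSeries.coeff_mk]
  rw [hunion, ← Nat.cast_sum, Nat.cast_inj, Set.ncard_iUnion_of_finite, finsum_eq_sum_of_fintype]
  · intro a
    refine (hfin t).subset ?_
    rintro x ⟨⟨h1, h2⟩, h3⟩
    exact ⟨⟨h1, hsub a h2⟩, h3⟩
  · intro a a' haa
    rw [Function.onFun, Set.disjoint_left]
    rintro x ⟨⟨h1, h2⟩, h3⟩ ⟨⟨h1', h2'⟩, h3'⟩
    exact haa (((key x).1 ((key x).2 a h2)).unique h2 h2')

/-- Ehrhart–Macdonald reciprocity, in terms of the cone over a lattice polytope. -/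
theorem exists_numerator_reciprocity [FiniteDimensional ℝ V] {v : ι → V} {ht : V →ₗ[ℝ] ℝ}
    (hv : ∀ i, ht (v i) = 1) {L : AddSubgroup V} (hL : ∀ i, v i ∈ L)
    (hfin : ∀ t : ℕ, {x | x ∈ (L : Set V) ∩ coneHull v ∧ ht x = t}.Finite)
    {q : V} (hq : AvoidsSpans v q) {D D' : Set V}
    (hD : ∀ x, ∀ᶠ ε in 𝓝[>] (0 : ℝ), x + ε • q ∈ coneHull v ↔ x ∈ D)
    (hD' : ∀ x, ∀ᶠ ε in 𝓝[>] (0 : ℝ), x + ε • -q ∈ coneHull v ↔ x ∈ D') :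
    ∃ f g : PowerSeries ℤ, (1 - PowerSeries.X) ^ Module.finrank ℝ V * heightSeries ht (L ∩ D) = f ∧
      (1 - PowerSeries.X) ^ Module.finrank ℝ V * heightSeries ht (L ∩ D') = g ∧
      (∀ t, Module.finrank ℝ V < t → PowerSeries.coeff t f = 0) ∧
      (∀ t, Module.finrank ℝ V < t → PowerSeries.coeff t g = 0) ∧
      ∀ t ≤ Module.finrank ℝ V,
        PowerSeries.coeff (Module.finrank ℝ V - t) f = PowerSeries.coeff t g := by
  obtain ⟨T, b, hbv, hgen, hcone, huniq⟩ := exists_triangulation v ht hv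
  have hb : ∀ a i, ht (b a i) = 1 := fun a i => by
    obtain ⟨j, hj⟩ := hbv a i
    rw [← hj, hv]
  have hbL : ∀ a i, b a i ∈ L := fun a i => by
    obtain ⟨j, hj⟩ := hbv a i
    rw [← hj]
    exact hL j
  have hpow : ∀ p, AvoidsSpans v p → ∀ a,
      (1 - PowerSeries.X) ^ Module.finrank ℝ V * heightSeries ht (L ∩ halfOpenBox (b a) p ∅) =
      heightSeries ht (L ∩ halfOpenBox (b a) p Set.univ) := by
    intro p hp a
    have h := one_sub_X_pow_mul_heightSeries (hb a) (hbL a) (hgen p hp a) (fun t => by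
      refine (hfin t).subset ?_
      rintro x ⟨⟨h1, h2⟩, h3⟩
      exact ⟨⟨h1, hcone a x fun i => (h2.1 i).1⟩, h3⟩)
    rwa [Fintype.card_fin] at h
  refine ⟨∑ a, heightSeries ht (L ∩ halfOpenBox (b a) q Set.univ),
    ∑ a, heightSeries ht (L ∩ halfOpenBox (b a) (-q) Set.univ), ?_, ?_, ?_, ?_, ?_⟩
  · rw [heightSeries_eq_sum hcone huniq hq (hgen q hq) hD hfin, Finset.mul_sum]
    exact Finset.sum_congr rfl fun a _ => hpow q hq a
  · rw [heightSeries_eq_sum hcone huniq hq.neg (hgen _ hq.neg) hD' hfin, Finset.mul_sum]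
    exact Finset.sum_congr rfl fun a _ => hpow _ hq.neg a
  · intro t h
    rw [map_sum]
    exact Finset.sum_eq_zero fun a _ => coeff_heightSeries_box_of_lt (hb a) (by simpa using h)
  · intro t h
    rw [map_sum]
    exact Finset.sum_eq_zero fun a _ => coeff_heightSeries_box_of_lt (hb a) (by simpa using h)
  · intro t h
    rw [map_sum, map_sum]
    refine Finset.sum_congr rfl fun a _ => ?_
    have := coeff_heightSeries_box_reflect (q := q) (hb a) (hbL a) (t := t) (by simpa using h)
    rwa [Fintype.card_fin] at this

end Reciprocity

/-! ### The cone over the polytope and its lattice points -/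

section Homogenization

variable {m d : ℕ}

/-- The cone over `positivePolyhedron M`. -/
def homogenizedCone (M : Matrix (Fin m) (Fin d) ℤ) : Set ((Fin d → ℝ) × ℝ) :=
  {p | (∀ j, 0 ≤ p.1 j) ∧ ∀ i, ∑ j, (M i j : ℝ) * p.1 j ≤ p.2}

/-- The interior of the cone over `positivePolyhedron M`. -/
def strictCone (M : Matrix (Fin m) (Fin d) ℤ) : Set ((Fin d → ℝ) × ℝ) :=
  {p | (∀ j, 0 < p.1 j) ∧ ∀ i, ∑ j, (M i j : ℝ) * p.1 j < p.2}

/-- The points of `ℝᵈ × ℝ` with integer coordinates. -/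
def integerLattice (d : ℕ) : AddSubgroup ((Fin d → ℝ) × ℝ) :=
  (AddMonoidHom.mk' (fun z : (Fin d → ℤ) × ℤ => ((fun j => (z.1 j : ℝ), (z.2 : ℝ)) :
    (Fin d → ℝ) × ℝ)) fun a b => by ext <;> simp).range

theorem mem_integerLattice {p : (Fin d → ℝ) × ℝ} :
    p ∈ integerLattice d ↔ ∃ (z : Fin d → ℤ) (t : ℤ), ((fun j => (z j : ℝ)), (t : ℝ)) = p := by
  simp [integerLattice, AddMonoidHom.mem_range]

variable {M : Matrix (Fin m) (Fin d) ℤ}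

theorem strictCone_subset : strictCone M ⊆ homogenizedCone M :=
  fun _ h => ⟨fun j => (h.1 j).le, fun i => (h.2 i).le⟩

theorem isOpen_strictCone : IsOpen (strictCone M) := by
  have h1 : IsOpen {p : (Fin d → ℝ) × ℝ | ∀ j, 0 < p.1 j} := by
    simp only [Set.ofPred_forall]
    exact isOpen_iInter_of_finite fun j => isOpen_lt (by fun_prop) (by fun_prop)
  have h2 : IsOpen {p : (Fin d → ℝ) × ℝ | ∀ i, ∑ j, (M i j : ℝ) * p.1 j < p.2} := by
    simp only [Set.ofPred_forall]
    exact isOpen_iInter_of_finite fun j => isOpen_lt (by fun_prop) (by fun_prop)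
  exact h1.inter h2

theorem isClosed_homogenizedCone : IsClosed (homogenizedCone M) := by
  have h1 : IsClosed {p : (Fin d → ℝ) × ℝ | ∀ j, 0 ≤ p.1 j} := by
    simp only [Set.ofPred_forall]
    exact isClosed_iInter fun j => isClosed_le (by fun_prop) (by fun_prop)
  have h2 : IsClosed {p : (Fin d → ℝ) × ℝ | ∀ i, ∑ j, (M i j : ℝ) * p.1 j ≤ p.2} := by
    simp only [Set.ofPred_forall]
    exact isClosed_iInter fun j => isClosed_le (by fun_prop) (by fun_prop)
  exact h1.inter h2

theorem add_mem_homogenizedCone {p q : (Fin d → ℝ) × ℝ} (hp : p ∈ homogenizedCone M)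
    (hq : q ∈ homogenizedCone M) : p + q ∈ homogenizedCone M := by
  refine ⟨fun j => add_nonneg (hp.1 j) (hq.1 j), fun i => ?_⟩
  simp only [Prod.fst_add, Prod.snd_add, Pi.add_apply, mul_add, Finset.sum_add_distrib]
  exact add_le_add (hp.2 i) (hq.2 i)

theorem add_mem_strictCone {p q : (Fin d → ℝ) × ℝ} (hp : p ∈ homogenizedCone M)
    (hq : q ∈ strictCone M) : p + q ∈ strictCone M := by
  refine ⟨fun j => add_pos_of_nonneg_of_pos (hp.1 j) (hq.1 j), fun i => ?_⟩
  simp only [Prod.fst_add, Prod.snd_add, Pi.add_apply, mul_add, Finset.sum_add_distrib]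
  exact add_lt_add_of_le_of_lt (hp.2 i) (hq.2 i)

theorem smul_mem_homogenizedCone {p : (Fin d → ℝ) × ℝ} (hp : p ∈ homogenizedCone M) {r : ℝ}
    (hr : 0 ≤ r) : r • p ∈ homogenizedCone M := by
  refine ⟨fun j => mul_nonneg hr (hp.1 j), fun i => ?_⟩
  simp only [Prod.smul_fst, Prod.smul_snd, Pi.smul_apply, smul_eq_mul, mul_left_comm _ r,
    ← Finset.mul_sum]
  exact mul_le_mul_of_nonneg_left (hp.2 i) hr

theorem smul_mem_strictCone {p : (Fin d → ℝ) × ℝ} (hp : p ∈ strictCone M) {r : ℝ}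
    (hr : 0 < r) : r • p ∈ strictCone M := by
  refine ⟨fun j => mul_pos hr (hp.1 j), fun i => ?_⟩
  simp only [Prod.smul_fst, Prod.smul_snd, Pi.smul_apply, smul_eq_mul, mul_left_comm _ r,
    ← Finset.mul_sum]
  exact mul_lt_mul_of_pos_left (hp.2 i) hr

theorem eventually_add_smul_mem_homogenizedCone {q : (Fin d → ℝ) × ℝ}
    (hq : q ∈ homogenizedCone M) (x : (Fin d → ℝ) × ℝ) :
    ∀ᶠ ε in 𝓝[>] (0 : ℝ), x + ε • q ∈ homogenizedCone M ↔ x ∈ homogenizedCone M := by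
  by_cases hx : x ∈ homogenizedCone M
  · filter_upwards [self_mem_nhdsWithin] with ε hε
    exact ⟨fun _ => hx, fun _ =>
      add_mem_homogenizedCone hx (smul_mem_homogenizedCone hq (le_of_lt hε))⟩
  · have hlim : Tendsto (fun ε : ℝ => x + ε • q) (𝓝[>] 0) (𝓝 (x + (0 : ℝ) • q)) :=
      (Continuous.tendsto (by fun_prop) 0).mono_left nhdsWithin_le_nhds
    rw [zero_smul, add_zero] at hlim
    filter_upwards [hlim.eventually (isClosed_homogenizedCone.isOpen_compl.mem_nhds hx)] with ε hε
    exact ⟨fun h => absurd h hε, fun h => absurd h hx⟩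

/-- Interior points survive by openness; conversely, if `x - ε • q` is in the cone, adding back the
interior vector `ε • q` makes `x` interior. -/
theorem eventually_add_smul_neg_mem_homogenizedCone {q : (Fin d → ℝ) × ℝ}
    (hq : q ∈ strictCone M) (x : (Fin d → ℝ) × ℝ) :
    ∀ᶠ ε in 𝓝[>] (0 : ℝ), x + ε • -q ∈ homogenizedCone M ↔ x ∈ strictCone M := by
  by_cases hx : x ∈ strictCone M
  · have hlim : Tendsto (fun ε : ℝ => x + ε • -q) (𝓝[>] 0) (𝓝 (x + (0 : ℝ) • -q)) :=
      (Continuous.tendsto (by fun_prop) 0).mono_left nhdsWithin_le_nhds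
    rw [zero_smul, add_zero] at hlim
    filter_upwards [hlim.eventually (isOpen_strictCone.mem_nhds hx)] with ε hε
    exact ⟨fun _ => hx, fun _ => strictCone_subset hε⟩
  · filter_upwards [self_mem_nhdsWithin] with ε hε
    refine ⟨fun h => ?_, fun h => absurd h hx⟩
    have := add_mem_strictCone h (smul_mem_strictCone hq hε)
    simpa using this

theorem inv_smul_mem_positivePolyhedron {p : (Fin d → ℝ) × ℝ} {r : ℝ} (hr : 0 < r) (hpr : p.2 ≤ r)
    (hp : p ∈ homogenizedCone M) : r⁻¹ • p.1 ∈ positivePolyhedron M := by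
  have h := smul_mem_homogenizedCone hp (inv_nonneg.2 hr.le)
  refine ⟨h.1, fun i => (h.2 i).trans ?_⟩
  rw [Prod.smul_snd, smul_eq_mul, inv_mul_le_iff₀ hr, mul_one]
  exact hpr

theorem fst_le_of_mem_homogenizedCone {R : ℝ} (hR : ∀ x ∈ positivePolyhedron M, ∀ j, x j ≤ R)
    {p : (Fin d → ℝ) × ℝ} (hp : p ∈ homogenizedCone M) {r : ℝ} (hr : 0 ≤ r) (hpr : p.2 ≤ r)
    (j : Fin d) : p.1 j ≤ r * R := by
  have hpos : ∀ r', 0 < r' → p.2 ≤ r' → p.1 j ≤ r' * R := fun r' hr hpr => by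
    have h := hR _ (inv_smul_mem_positivePolyhedron hr hpr hp) j
    rwa [Pi.smul_apply, smul_eq_mul, inv_mul_le_iff₀ hr] at h
  -- Rescaling to the polytope needs `r > 0`; the case `r = 0`, which says that the apex is the only
  -- point at height zero, is a limit.
  have hlim : Tendsto (fun ε : ℝ => (r + ε) * R) (𝓝[>] 0) (𝓝 ((r + 0) * R)) :=
    (Continuous.tendsto (by fun_prop) 0).mono_left nhdsWithin_le_nhds
  rw [add_zero] at hlim
  refine ge_of_tendsto hlim ?_
  filter_upwards [self_mem_nhdsWithin] with ε (hε : 0 < ε)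
  exact hpos _ (by linarith) (by linarith)

theorem fst_eq_zero_of_snd_nonpos {R : ℝ} (hR : ∀ x ∈ positivePolyhedron M, ∀ j, x j ≤ R)
    {p : (Fin d → ℝ) × ℝ} (hp : p ∈ homogenizedCone M) (h : p.2 ≤ 0) : p.1 = 0 := by
  funext j
  refine le_antisymm ?_ (hp.1 j)
  simpa using fst_le_of_mem_homogenizedCone hR hp le_rfl h j

/-- At negative height, boundedness forces `p.1 = 0`, and then any row inequality fails. A row
exists because `0 < m`. -/
theorem snd_nonneg_of_mem_homogenizedCone (hm : 0 < m) {R : ℝ}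
    (hR : ∀ x ∈ positivePolyhedron M, ∀ j, x j ≤ R)
    {p : (Fin d → ℝ) × ℝ} (hp : p ∈ homogenizedCone M) : 0 ≤ p.2 := by
  by_contra! h
  have h1 := hp.2 ⟨0, hm⟩
  rw [fst_eq_zero_of_snd_nonpos hR hp h.le] at h1
  simp at h1
  linarith

theorem coneHull_eq_homogenizedCone (hm : 0 < m) {R : ℝ}
    (hR : ∀ x ∈ positivePolyhedron M, ∀ j, x j ≤ R) {W : Finset (Fin d → ℤ)}
    (hW : positivePolyhedron M =
      convexHull ℝ ((fun v j => (v j : ℝ)) '' (W : Set (Fin d → ℤ)))) :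
    coneHull (fun u : W => (((fun j => (u.1 j : ℝ)), 1) : (Fin d → ℝ) × ℝ)) =
      homogenizedCone M := by
  set v := fun u : W => (((fun j => (u.1 j : ℝ)), 1) : (Fin d → ℝ) × ℝ) with hv
  have hsmul : ∀ p ∈ coneHull v, ∀ r : ℝ, 0 ≤ r → r • p ∈ coneHull v := by
    rintro _ ⟨c, hc, rfl⟩ r hr
    exact ⟨fun i => r * c i, fun i => mul_nonneg hr (hc i), by
      simp only [Finset.smul_sum, smul_smul]⟩
  have hadd : ∀ p ∈ coneHull v, ∀ q ∈ coneHull v, p + q ∈ coneHull v := by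
    rintro _ ⟨c, hc, rfl⟩ _ ⟨c', hc', rfl⟩
    exact ⟨fun i => c i + c' i, fun i => add_nonneg (hc i) (hc' i), by
      simp only [add_smul, Finset.sum_add_distrib]⟩
  apply Set.Subset.antisymm
  · rintro _ ⟨c, hc, rfl⟩
    refine Finset.sum_induction _ (· ∈ homogenizedCone M) (fun _ _ => add_mem_homogenizedCone)
      ⟨by simp, by simp⟩ fun u _ => smul_mem_homogenizedCone ?_ (hc u)
    have h : (fun j => (u.1 j : ℝ)) ∈ positivePolyhedron M :=
      hW ▸ subset_convexHull ℝ _ ⟨u.1, u.2, rfl⟩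
    exact h
  · intro p hp
    have hpoly : ∀ x ∈ positivePolyhedron M, ((x, 1) : (Fin d → ℝ) × ℝ) ∈ coneHull v := by
      have hconv : Convex ℝ {x : Fin d → ℝ | ((x, 1) : (Fin d → ℝ) × ℝ) ∈ coneHull v} := by
        intro x hx y hy a b ha hb hab
        have h := hadd _ (hsmul _ hx a ha) _ (hsmul _ hy b hb)
        simpa [hab] using h
      rw [hW]
      refine convexHull_min ?_ hconv
      rintro _ ⟨u, hu, rfl⟩
      classical
      exact ⟨Pi.single ⟨u, hu⟩ 1, fun i => by by_cases h : i = ⟨u, hu⟩ <;> simp [h],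
        by simp [Pi.single_apply, ite_smul, hv]⟩
    rcases (snd_nonneg_of_mem_homogenizedCone hm hR hp).eq_or_lt with h | h
    · have h1 := fst_eq_zero_of_snd_nonpos hR hp h.symm.le
      have : p = 0 := Prod.ext h1 h.symm
      exact ⟨0, by simp, by simp [this]⟩
    · have h1 := hsmul _ (hpoly _ (inv_smul_mem_positivePolyhedron h le_rfl hp)) _ h.le
      convert h1 using 1
      ext <;> simp [mul_inv_cancel_left₀ h.ne']

theorem finite_lattice_height {R : ℝ} (hR : ∀ x ∈ positivePolyhedron M, ∀ j, x j ≤ R) (t : ℕ) :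
    {x | x ∈ (integerLattice d : Set _) ∩ homogenizedCone M ∧
      LinearMap.snd ℝ (Fin d → ℝ) ℝ x = t}.Finite := by
  refine ((Set.finite_Icc (0 : Fin d → ℤ) fun _ => ⌈t * R⌉).image
    fun z => (((fun j => (z j : ℝ)), (t : ℝ)) : (Fin d → ℝ) × ℝ)).subset ?_
  rintro x ⟨⟨hx, hC⟩, hxt⟩
  obtain ⟨z, s, rfl⟩ := mem_integerLattice.1 hx
  simp only [LinearMap.snd_apply] at hxt
  refine ⟨z, ⟨fun j => ?_, fun j => ?_⟩, by rw [hxt]⟩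
  · have := hC.1 j
    simpa using this
  · have h := fst_le_of_mem_homogenizedCone hR hC (Nat.cast_nonneg t) hxt.le j
    have h' : (z j : ℝ) ≤ ⌈t * R⌉ := h.trans (Int.le_ceil _)
    exact_mod_cast h'

theorem heightSeries_homogenizedCone {R : ℝ}
    (hR : ∀ x ∈ positivePolyhedron M, ∀ j, x j ≤ R) :
    heightSeries (LinearMap.snd ℝ (Fin d → ℝ) ℝ) (integerLattice d ∩ homogenizedCone M) =
      ehrhartSeries (positivePolyhedron M) := by
  ext t
  rw [heightSeries, ehrhartSeries, PowerSeries.coeff_mk, PowerSeries.coeff_mk]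
  split_ifs with h0
  · have : {x | x ∈ (integerLattice d : Set _) ∩ homogenizedCone M ∧
        LinearMap.snd ℝ (Fin d → ℝ) ℝ x = t} = {0} := by
      ext x
      simp only [Set.mem_singleton_iff, Set.mem_ofPred_eq, LinearMap.snd_apply, h0, Nat.cast_zero]
      constructor
      · rintro ⟨⟨-, h1⟩, h2⟩
        exact Prod.ext (fst_eq_zero_of_snd_nonpos hR h1 h2.le) h2
      · rintro rfl
        exact ⟨⟨(integerLattice d).zero_mem, by simp, by simp⟩, rfl⟩
    rw [this, Set.ncard_singleton, Nat.cast_one]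
  · have ht : (0 : ℝ) < t := Nat.cast_pos.2 (Nat.pos_of_ne_zero h0)
    rw [latticeCount, Nat.cast_inj]
    refine (Set.ncard_congr (fun z _ => (((fun j => (z j : ℝ)), (t : ℝ)) : (Fin d → ℝ) × ℝ))
      ?_ ?_ ?_).symm
    · rintro z ⟨x, hx, hxz⟩
      refine ⟨⟨mem_integerLattice.2 ⟨z, t, by simp⟩, ?_⟩, rfl⟩
      have h : ((x, 1) : (Fin d → ℝ) × ℝ) ∈ homogenizedCone M := hx
      have h' := smul_mem_homogenizedCone h ht.le
      simp only at hxz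
      rwa [Prod.smul_mk, hxz, smul_eq_mul, mul_one] at h'
    · intro a b _ _ hab
      funext j
      have := congrFun (congrArg Prod.fst hab) j
      simpa using this
    · rintro x ⟨⟨hx, hC⟩, hxt⟩
      obtain ⟨z, s, rfl⟩ := mem_integerLattice.1 hx
      simp only [LinearMap.snd_apply] at hxt
      refine ⟨z, ?_, by rw [hxt]⟩
      rw [Set.mem_ofPred_eq, Set.mem_smul_set_iff_inv_smul_mem₀ ht.ne']
      exact inv_smul_mem_positivePolyhedron ht hxt.le hC

theorem heightSeries_strictCone (hm : 0 < m) {R : ℝ}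
    (hR : ∀ x ∈ positivePolyhedron M, ∀ j, x j ≤ R) {k : ℕ}
    (hk : ∀ i, (k : ℤ) = ∑ j, M i j + 1) :
    heightSeries (LinearMap.snd ℝ (Fin d → ℝ) ℝ) (integerLattice d ∩ strictCone M) =
      PowerSeries.X ^ k *
        heightSeries (LinearMap.snd ℝ (Fin d → ℝ) ℝ) (integerLattice d ∩ homogenizedCone M) := by
  -- This vector has lattice distance one from every defining hyperplane, because each row sum is `k
  -- - 1`.
  let o : (Fin d → ℝ) × ℝ := (fun _ => 1, k)
  have ho : o ∈ integerLattice d := mem_integerLattice.2 ⟨fun _ => 1, k, by simp [o]⟩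
  have hkR : ∀ i, ∑ j, (M i j : ℝ) = k - 1 := fun i => by
    have := congrArg (Int.cast : ℤ → ℝ) (hk i)
    push_cast at this
    linarith
  have hmem : ∀ x ∈ integerLattice d, x ∈ strictCone M ↔ x - o ∈ homogenizedCone M := by
    intro x hx
    obtain ⟨z, s, rfl⟩ := mem_integerLattice.1 hx
    refine and_congr (forall_congr' fun j => ?_) (forall_congr' fun i => ?_)
    · simp only [o, Prod.fst_sub, Pi.sub_apply, sub_nonneg]
      norm_cast
    · simp only [o, Prod.fst_sub, Prod.snd_sub, Pi.sub_apply, mul_sub, Finset.sum_sub_distrib,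
        mul_one, hkR]
      have : ∑ j, (M i j : ℝ) * z j < s ↔ ∑ j, (M i j : ℝ) * z j + 1 ≤ s := by
        norm_cast
      rw [this]
      constructor <;> intro h <;> linarith
  ext t
  rw [PowerSeries.coeff_X_pow_mul']
  simp only [heightSeries, PowerSeries.coeff_mk]
  split_ifs with hkt
  · rw [Nat.cast_inj]
    refine Set.ncard_congr (fun x _ => x - o) ?_ ?_ ?_
    · rintro x ⟨⟨h1, h2⟩, h3⟩
      refine ⟨⟨(integerLattice d).sub_mem h1 ho, (hmem x h1).1 h2⟩, ?_⟩
      rw [map_sub, h3]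
      simp [o, hkt]
    · intro x y _ _ h
      simpa using h
    · rintro x ⟨⟨h1, h2⟩, h3⟩
      have h4 := (integerLattice d).add_mem h1 ho
      refine ⟨x + o, ⟨⟨h4, (hmem _ h4).2 (by simpa using h2)⟩, ?_⟩, by simp⟩
      rw [map_add, h3]
      simp [o, hkt]
  · rw [Nat.cast_eq_zero]
    convert Set.ncard_empty ((Fin d → ℝ) × ℝ)
    rw [Set.eq_empty_iff_forall_notMem]
    rintro x ⟨⟨h1, h2⟩, h3⟩
    have h := snd_nonneg_of_mem_homogenizedCone hm hR ((hmem x h1).1 h2)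
    simp only [LinearMap.snd_apply] at h3
    simp only [Prod.snd_sub, h3, o, sub_nonneg, Nat.cast_le] at h
    exact hkt h

end Homogenization

/-! ### Symmetry of the numerator and conclusion -/

/-- A power series `f` with `zⁿ f(1/z) = zᵏ f(z)` and constant term one is a palindromic
polynomial of degree `n - k`. -/
theorem exists_palindromic_polynomial {f g : PowerSeries ℤ} {n k : ℕ}
    (hf : ∀ t, n < t → PowerSeries.coeff t f = 0) (hg : ∀ t, n < t → PowerSeries.coeff t g = 0)
    (hfg : ∀ t ≤ n, PowerSeries.coeff (n - t) f = PowerSeries.coeff t g)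
    (hgf : g = PowerSeries.X ^ k * f) (h1 : PowerSeries.coeff 0 f = 1) :
    k ≤ n ∧ ∃ h : Polynomial ℤ, (h : PowerSeries ℤ) = f ∧ h.natDegree = n - k ∧ IsPalindromic h := by
  have hgk : ∀ i, PowerSeries.coeff (i + k) g = PowerSeries.coeff i f := fun i => by
    rw [hgf, PowerSeries.coeff_X_pow_mul]
  have hkn : k ≤ n := by
    by_contra! h
    have := hgk 0
    rw [zero_add, hg k h, h1] at this
    exact zero_ne_one this
  have hcoeff : ∀ i, (f.trunc (n + 1)).coeff i = PowerSeries.coeff i f := fun i => by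
    rw [PowerSeries.coeff_trunc]
    split_ifs with hi
    · rfl
    · exact (hf i (by omega)).symm
  have hsymm : ∀ i ≤ n - k, PowerSeries.coeff (n - k - i) f = PowerSeries.coeff i f := by
    intro i hi
    rw [← hgk i, ← hfg _ (by omega)]
    congr 2
    omega
  have hdeg : (f.trunc (n + 1)).natDegree = n - k := by
    refine Polynomial.natDegree_eq_of_le_of_coeff_ne_zero ?_ ?_
    · rw [Polynomial.natDegree_le_iff_coeff_eq_zero]
      intro i hi
      rw [hcoeff]
      rcases lt_or_ge n i with h | h
      · exact hf i h
      · have := hfg (n - i) (by omega)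
        rw [Nat.sub_sub_self h, hgf, PowerSeries.coeff_X_pow_mul', if_neg (by omega)] at this
        exact this
    · rw [hcoeff, ← hsymm _ le_rfl, Nat.sub_self, h1]
      exact one_ne_zero
  refine ⟨hkn, f.trunc (n + 1), ?_, hdeg, ?_⟩
  · ext i
    rw [Polynomial.coeff_coe, hcoeff]
  · ext i
    rw [Polynomial.coeff_reverse, hdeg, hcoeff, hcoeff]
    rcases le_or_gt i (n - k) with h | h
    · rw [Polynomial.revAt_le h, hsymm i h]
    · rw [Polynomial.revAt_eq_self_of_lt h]

theorem mainTheorem2 {m d : ℕ} (hm : 0 < m) (M : Matrix (Fin m) (Fin d) ℤ)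
    (P : Set (Fin d → ℝ)) (hP : IsRegularPositiveReflexive P M)
    (k : ℤ) (hk : ∀ i : Fin m, k = ∑ j, M i j + 1) :
    ∃ h : Polynomial ℤ, IsHStarPolynomial P h ∧
      (h.natDegree : ℤ) = (d : ℤ) - k + 1 ∧ IsPalindromic h := by
  obtain rfl := hP.eq_polyhedron
  obtain ⟨W, hW⟩ := hP.integral
  obtain ⟨R, hR⟩ : ∃ R : ℝ, ∀ x ∈ positivePolyhedron M, ∀ j, x j ≤ R := by
    have hb : Bornology.IsBounded (positivePolyhedron M) := by
      rw [hW, isBounded_convexHull]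
      exact (W.finite_toSet.image _).isBounded
    obtain ⟨R, hR⟩ := hb.exists_norm_le
    exact ⟨R, fun x hx j => (le_abs_self _).trans ((norm_le_pi_norm x j).trans (hR x hx))⟩
  have hkR : ∀ i, ∑ j, (M i j : ℝ) = k - 1 := fun i => by
    rw [hk i]
    push_cast
    ring
  -- The point `(1, …, 1, k - 1)` lies in the cone, whose points have nonnegative height.
  have hk1 : 0 ≤ k - 1 := by
    have h : (((fun _ => 1), (k : ℝ) - 1) : (Fin d → ℝ) × ℝ) ∈ homogenizedCone M :=
      ⟨fun _ => zero_le_one, fun i => by simp [hkR]⟩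
    have := snd_nonneg_of_mem_homogenizedCone hm hR h
    simp only at this
    exact_mod_cast this
  lift k to ℕ using by omega
  set v := fun u : W => (((fun j => (u.1 j : ℝ)), 1) : (Fin d → ℝ) × ℝ)
  have hcone : coneHull v = homogenizedCone M := coneHull_eq_homogenizedCone hm hR hW
  obtain ⟨q, hqC, hq⟩ := exists_mem_forall_notMem_submodule
    (fun S : {S : Set W // Submodule.span ℝ (v '' S) ≠ ⊤} => Submodule.span ℝ (v '' S.1))
    (fun S => S.2) (isOpen_strictCone (M := M))
    ⟨(fun _ => 1, k), fun _ => zero_lt_one, fun i => by simp [hkR]⟩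
  have hfinrank : Module.finrank ℝ ((Fin d → ℝ) × ℝ) = d + 1 := by simp
  obtain ⟨f, g, hf, hg, hf0, hg0, hfg⟩ := exists_numerator_reciprocity (v := v)
    (ht := LinearMap.snd ℝ (Fin d → ℝ) ℝ) (L := integerLattice d) (q := q)
    (D := homogenizedCone M) (D' := strictCone M) (fun _ => rfl)
    (fun u => mem_integerLattice.2 ⟨u.1, 1, by simp [v]⟩)
    (hcone ▸ finite_lattice_height hR) (fun S hS => hq ⟨S, hS⟩)
    (hcone ▸ eventually_add_smul_mem_homogenizedCone (strictCone_subset hqC))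
    (hcone ▸ eventually_add_smul_neg_mem_homogenizedCone hqC)
  rw [hfinrank] at hf hg hf0 hg0 hfg
  rw [heightSeries_homogenizedCone hR] at hf
  rw [heightSeries_strictCone hm hR hk, heightSeries_homogenizedCone hR, mul_left_comm, hf] at hg
  obtain ⟨hkd, h, hh, hdeg, hpal⟩ := exists_palindromic_polynomial hf0 hg0 hfg hg.symm (by
    rw [← hf]
    simp [ehrhartSeries])
  refine ⟨h, hh.trans hf.symm, ?_, hpal⟩
  rw [hdeg]
  push_cast [hkd]
  ring
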